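/- Let $n \ge 1$ and let $\mathcal S_n$ be the set of all parenthesisations (orderings) of a matrix product $M_1 M_2 \cdots M_n$. An instance is a tuple $\boldsymbol k = (k_0, k_1, \ldots, k_n)$ of positive integers, where $M_i$ has size $k_{i-1} \times k_i$. The cost $T(\mathcal A, \boldsymbol k)$ of an ordering $\mathcal A \in \mathcal S_n$ on $\boldsymbol k$ is the sum of $k_a k_b k_c$ over all triplets $(a,b,c)$ such that $\mathcal A$ multiplies $(M_{a+1} \cdots M_b)$ with $(M_{b+1} \cdots M_c)$. The ordering $\mathcal A$ is uniquely optimal on $\boldsymbol k$ if $T(\mathcal A, \boldsymbol k) < T(\mathcal B, \boldsymbol k)$ for every $\mathcal B \in \mathcal S_n \setminus \{\mathcal A\}$, and it is useful if it is uniquely optimal on at least one instance. Theorem. Every ordering $\mathcal A \in \mathcal S_n$ is uniquely optimal on infinitely many instances $\boldsymbol k$. In particular, every ordering is useful. -/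

import Mathlib

/-- `Parenthesisation n a c` is the type of complete parenthesisations of the partial product
`M_{a+1} M_{a+2} ⋯ M_c` of a chain `M_1 M_2 ⋯ M_n`, where `a` and `c` range over `{0, 1, …, n}`:
such a product is either a single matrix `M_{i+1}` (with `a = i`, `c = i + 1`), or it is
obtained by multiplying `(M_{a+1} ⋯ M_b)` with `(M_{b+1} ⋯ M_c)`, each parenthesised. -/
inductive Parenthesisation (n : ℕ) : Fin (n + 1) → Fin (n + 1) → Type
  | single (i : Fin n) : Parenthesisation n i.castSucc i.succ
  | mul {a b c : Fin (n + 1)} (l : Parenthesisation n a b) (r : Parenthesisation n b c) :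
      Parenthesisation n a c

/-- The set of index triplets `(a, b, c)` of a parenthesisation: one for every multiplication of
`(M_{a+1} ⋯ M_b)` with `(M_{b+1} ⋯ M_c)` that it performs. -/
def Parenthesisation.triplets {n : ℕ} :
    {a c : Fin (n + 1)} → Parenthesisation n a c →
      Finset (Fin (n + 1) × Fin (n + 1) × Fin (n + 1))
  | _, _, .single _ => ∅
  | _, _, .mul (a := a) (b := b) (c := c) l r => insert (a, b, c) (l.triplets ∪ r.triplets)

/-- The set `S_n` of orderings (parenthesisations) of the whole chain `M_1 M_2 ⋯ M_n`. -/
abbrev ChainOrdering (n : ℕ) : Type := Parenthesisation n 0 (Fin.last n)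

/-- An instance of the matrix chain multiplication problem of length `n`: the tuple
`(k_0, k_1, …, k_n)` of positive integers such that `M_i` has size `k_{i-1} × k_i`. -/
abbrev ChainInstance (n : ℕ) : Type := Fin (n + 1) → ℕ+

namespace ChainOrdering

/-- The cost `T(A, k)`: the sum of `k_a k_b k_c` over the index triplets `(a, b, c)` of `A`. -/
def cost {n : ℕ} (A : ChainOrdering n) (k : ChainInstance n) : ℕ :=
  ∑ t ∈ Parenthesisation.triplets A, (k t.1 : ℕ) * (k t.2.1 : ℕ) * (k t.2.2 : ℕ)

/-- `A` is uniquely optimal on `k`: its cost is strictly lower than that of every other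
ordering. -/
def IsUniquelyOptimal {n : ℕ} (A : ChainOrdering n) (k : ChainInstance n) : Prop :=
  ∀ B : ChainOrdering n, B ≠ A → cost A k < cost B k

/-- `A` is useful: it is uniquely optimal on at least one instance. -/
def IsUseful {n : ℕ} (A : ChainOrdering n) : Prop :=
  ∃ k : ChainInstance n, IsUniquelyOptimal A k

end ChainOrdering

namespace Parenthesisation

variable {n : ℕ}

/-! On `k = N + e` the cost is a cubic in `N`. Its leading coefficient counts triplets, so it is the
same for all orderings; for large `N` the linear weight, the sum of `e a + e b + e c` over triplets,
decides. It thus suffices to find `e` for which `A` alone minimises this weight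
(`exists_linear_optimal`): make the vertex of the outermost split of `A` much lighter than the other
interior vertices, and recurse on both sides. Any competitor splitting elsewhere can be cut at the
light vertex at a gain (`exists_cut`). Scaling one instance gives infinitely many. -/

theorem lt {a c : Fin (n + 1)} (A : Parenthesisation n a c) : a < c := by
  induction A with
  | single i => exact Fin.castSucc_lt_succ
  | mul l r hl hr => exact hl.trans hr

theorem heq_single {a c : Fin (n + 1)} (B : Parenthesisation n a c) (i : Fin n)
    (ha : a = i.castSucc) (hc : c = i.succ) : HEq B (single i) := by
  cases B with
  | single j =>
    obtain rfl : j = i := Fin.castSucc_injective _ ha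
    rfl
  | mul l r =>
    have hl := l.lt
    have hr := r.lt
    subst ha hc
    simp only [Fin.lt_def, Fin.val_castSucc, Fin.val_succ] at hl hr
    omega

theorem eq_single {i : Fin n} (B : Parenthesisation n i.castSucc i.succ) : B = single i :=
  eq_of_heq (B.heq_single i rfl rfl)

theorem bounds_of_mem_triplets {a c : Fin (n + 1)} (A : Parenthesisation n a c) :
    ∀ t ∈ A.triplets, a ≤ t.1 ∧ t.1 < t.2.1 ∧ t.2.1 < t.2.2 ∧ t.2.2 ≤ c := by
  induction A with
  | single i => simp [triplets]
  | mul l r hl hr =>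
    intro t ht
    simp only [triplets, Finset.mem_insert, Finset.mem_union] at ht
    rcases ht with rfl | ht | ht
    · exact ⟨le_rfl, l.lt, r.lt, le_rfl⟩
    · obtain ⟨h₁, h₂, h₃, h₄⟩ := hl t ht
      exact ⟨h₁, h₂, h₃, h₄.trans r.lt.le⟩
    · obtain ⟨h₁, h₂, h₃, h₄⟩ := hr t ht
      exact ⟨l.lt.le.trans h₁, h₂, h₃, h₄⟩

/-- The sum of a weight `w` over the triplets of a parenthesisation. -/
def weight (w : Fin (n + 1) × Fin (n + 1) × Fin (n + 1) → ℕ) {a c : Fin (n + 1)}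
    (A : Parenthesisation n a c) : ℕ :=
  ∑ t ∈ A.triplets, w t

theorem weight_mul (w : Fin (n + 1) × Fin (n + 1) × Fin (n + 1) → ℕ) {a b c : Fin (n + 1)}
    (l : Parenthesisation n a b) (r : Parenthesisation n b c) :
    (l.mul r).weight w = w (a, b, c) + (l.weight w + r.weight w) := by
  unfold weight
  rw [triplets, Finset.sum_insert, Finset.sum_union]
  · refine Finset.disjoint_left.2 fun t hl hr => ?_
    have h₁ := l.bounds_of_mem_triplets t hl
    have h₂ := r.bounds_of_mem_triplets t hr
    exact absurd (h₁.2.1.trans (h₁.2.2.1.trans_le (h₁.2.2.2.trans h₂.1))) (lt_irrefl _)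
  · intro h
    rcases Finset.mem_union.1 h with h | h
    · exact absurd (l.bounds_of_mem_triplets _ h).2.2.2 (not_le.2 r.lt)
    · exact absurd (r.bounds_of_mem_triplets _ h).1 (not_le.2 l.lt)

theorem card_triplets {a c : Fin (n + 1)} (A : Parenthesisation n a c) :
    A.weight (fun _ => 1) + a + 1 = c := by
  induction A with
  | single i => simp [weight, triplets]
  | mul l r hl hr => rw [weight_mul]; omega

/-- The sum of the entries of a triplet with respect to `e`. -/
def tripletSum (e : Fin (n + 1) → ℕ) (t : Fin (n + 1) × Fin (n + 1) × Fin (n + 1)) : ℕ :=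
  e t.1 + e t.2.1 + e t.2.2

/-- Cutting a parenthesisation at a vertex `b` that is light compared to the other interior
vertices and to one of the end points. -/
theorem exists_cut (e : Fin (n + 1) → ℕ) (K : ℕ) (b : Fin (n + 1)) {x z : Fin (n + 1)}
    (B : Parenthesisation n x z) (hxb : x < b) (hbz : b < z)
    (hint : ∀ v, x < v → v < z → v ≠ b → K * e b ≤ e v) (hend : K * e b ≤ e x + e z) :
    ∃ (l : Parenthesisation n x b) (r : Parenthesisation n b z),
      l.weight (tripletSum e) + r.weight (tripletSum e) + K * e b + x * e b ≤
        B.weight (tripletSum e) + z * e b := by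
  induction B with
  | single i =>
    simp only [Fin.lt_def, Fin.val_castSucc, Fin.val_succ] at hxb hbz
    omega
  | @mul x y z p q hp hq =>
    have hxz : (x : ℕ) * e b ≤ z * e b := Nat.mul_le_mul_right _ (p.lt.trans q.lt).le
    -- Each triplet straddling `b` has its far end moved to `b`, which adds at most `e b`; the
    -- shrinking of the range `z - x` pays for it. The triplet with middle `b` disappears, saving at
    -- least `K * e b` by `hend`.
    rcases lt_trichotomy y b with hy | rfl | hy
    · have hey := hint y p.lt q.lt hy.ne
      obtain ⟨l, r, h⟩ := hq hy hbz (fun v h₁ h₂ => hint v (p.lt.trans h₁) h₂) (by omega)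
      refine ⟨p.mul l, r, ?_⟩
      have hxy : ((x : ℕ) + 1) * e b ≤ y * e b := Nat.mul_le_mul_right _ p.lt
      simp only [weight_mul, tripletSum] at h ⊢
      linarith
    · refine ⟨p, q, ?_⟩
      simp only [weight_mul, tripletSum]
      linarith
    · have hey := hint y p.lt q.lt hy.ne'
      obtain ⟨l, r, h⟩ := hp hxb hy (fun v h₁ h₂ => hint v h₁ (h₂.trans q.lt)) (by omega)
      refine ⟨l, r.mul q, ?_⟩
      have hyz : ((y : ℕ) + 1) * e b ≤ z * e b := Nat.mul_le_mul_right _ q.lt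
      simp only [weight_mul, tripletSum] at h ⊢
      linarith

/-- For every parenthesisation there are interior weights, bounded below by any prescribed `s`,
that make it the unique minimiser of the linear weight as long as the end points have weight at
most `s`. -/
theorem exists_linear_optimal {a c : Fin (n + 1)} (A : Parenthesisation n a c) (s : ℕ)
    (hs : 0 < s) :
    ∃ f : Fin (n + 1) → ℕ, (∀ v, s ≤ f v) ∧
      ∀ e : Fin (n + 1) → ℕ, (∀ v, a < v → v < c → e v = f v) → e a ≤ s → e c ≤ s →
        ∀ B : Parenthesisation n a c, B ≠ A →
          A.weight (tripletSum e) < B.weight (tripletSum e) := by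
  induction A generalizing s with
  | single i => exact ⟨fun _ => s, fun _ => le_rfl, fun _ _ _ _ B hB => absurd B.eq_single hB⟩
  | @mul a b c l r hl hr =>
    -- Why `n + 4`: cutting at `b` loses at most `n * e b`, reassembling around `b` at most `3 * e
    -- b` (`e b` twice and one end point, at most `s = e b`), and the last unit makes the inequality
    -- strict.
    have hsK : s ≤ (n + 4) * s := Nat.le_mul_of_pos_left s (by omega)
    obtain ⟨f, hf, hfl⟩ := hl ((n + 4) * s) (by positivity)
    obtain ⟨g, hg, hgr⟩ := hr ((n + 4) * s) (by positivity)
    refine ⟨fun v => if v < b then f v else if v = b then s else g v, fun v => ?_, ?_⟩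
    · dsimp only
      split_ifs
      · exact hsK.trans (hf v)
      · exact le_rfl
      · exact hsK.trans (hg v)
    intro e he hea hec B hB
    have heb : e b = s := by simp [he b l.lt r.lt]
    have hel : ∀ v, a < v → v < b → e v = f v := fun v h₁ h₂ => by
      simp [he v h₁ (h₂.trans r.lt), h₂]
    have her : ∀ v, b < v → v < c → e v = g v := fun v h₁ h₂ => by
      simp [he v (l.lt.trans h₁) h₂, h₁.not_gt, h₁.ne']
    have hL := hfl e hel (hea.trans hsK) (heb.trans_le hsK)
    have hR := hgr e her (heb.trans_le hsK) (hec.trans hsK)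
    have hL' : ∀ l' : Parenthesisation n a b, l.weight (tripletSum e) ≤ l'.weight (tripletSum e) := fun l' => by
      by_cases h : l' = l
      · rw [h]
      · exact (hL l' h).le
    have hR' : ∀ r' : Parenthesisation n b c, r.weight (tripletSum e) ≤ r'.weight (tripletSum e) := fun r' => by
      by_cases h : r' = r
      · rw [h]
      · exact (hR r' h).le
    have hint : ∀ v, a < v → v < c → v ≠ b → (n + 4) * e b ≤ e v := fun v h₁ h₂ h₃ => by
      rw [heb]
      rcases h₃.lt_or_gt with h | h
      · exact (hf v).trans_eq (hel v h₁ h).symm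
      · exact (hg v).trans_eq (her v h h₂).symm
    rw [weight_mul]
    have hcn : (c : ℕ) * e b ≤ n * e b := Nat.mul_le_mul_right _ (by omega)
    have hn4 : (n + 4) * e b = n * e b + 4 * e b := by ring
    clear hfl hgr hl hr hel her he hsK
    have key : ∀ y (p : Parenthesisation n a y) (q : Parenthesisation n y c),
        p.mul q ≠ l.mul r → tripletSum e (a, b, c) +
          (l.weight (tripletSum e) + r.weight (tripletSum e)) <
            (p.mul q).weight (tripletSum e) := by
      intro y p q hne
      rw [weight_mul]
      rcases lt_trichotomy y b with hy | rfl | hy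
      · have hey := hint y p.lt q.lt hy.ne
        obtain ⟨l', r', h⟩ := q.exists_cut e (n + 4) b hy r.lt
          (fun v h₁ h₂ => hint v (p.lt.trans h₁) h₂) (by omega)
        -- The pieces left of `b` form a competitor of `l`, those right of `b` one of `r`.
        have h₁ := hL' (p.mul l')
        have h₂ := hR' r'
        simp only [weight_mul, tripletSum] at h h₁ h₂ ⊢
        linarith [Nat.zero_le (y * e b)]
      · by_cases hp : p = l
        · have hq : q ≠ r := by rintro rfl; exact hne (by rw [hp])
          linarith [hL' p, hR q hq]
        · linarith [hL p hp, hR' q]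
      · have hey := hint y p.lt q.lt hy.ne'
        obtain ⟨l', r', h⟩ := p.exists_cut e (n + 4) b l.lt hy
          (fun v h₁ h₂ => hint v h₁ (h₂.trans q.lt)) (by omega)
        have h₁ := hL' l'
        have h₂ := hR' (r'.mul q)
        have hyn : (y : ℕ) * e b ≤ n * e b := Nat.mul_le_mul_right _ (by omega)
        simp only [weight_mul, tripletSum] at h h₁ h₂ ⊢
        linarith [Nat.zero_le (a * e b)]
    have huniv : ∀ {a' c'} (B' : Parenthesisation n a' c') (ha : a' = a) (hc : c' = c)
        (_ : HEq B' B), tripletSum e (a, b, c) +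
          (l.weight (tripletSum e) + r.weight (tripletSum e)) < B.weight (tripletSum e) := by
      intro a' c' B' ha hc hBB
      cases B' with
      | single i =>
        have h₁ := l.lt
        have h₂ := r.lt
        rw [← ha] at h₁
        rw [← hc] at h₂
        simp only [Fin.lt_def, Fin.val_castSucc, Fin.val_succ] at h₁ h₂
        omega
      | mul p q =>
        subst ha hc
        obtain rfl := eq_of_heq hBB
        exact key _ p q hB
    exact huniv B rfl rfl HEq.rfl

end Parenthesisation

namespace ChainOrdering

open Parenthesisation

variable {n : ℕ}

theorem cost_add (A : ChainOrdering n) (N : ℕ) (e : Fin (n + 1) → ℕ) (k : ChainInstance n)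
    (hk : ∀ v, (k v : ℕ) = N + e v) :
    cost A k = N ^ 3 * A.weight (fun _ => 1) + N ^ 2 * A.weight (tripletSum e) +
      N * A.weight (fun t => e t.1 * e t.2.1 + e t.1 * e t.2.2 + e t.2.1 * e t.2.2) +
      A.weight (fun t => e t.1 * e t.2.1 * e t.2.2) := by
  simp only [cost, weight, tripletSum, Finset.mul_sum, ← Finset.sum_add_distrib, hk]
  exact Finset.sum_congr rfl fun t _ => by ring

theorem cost_mul (A : ChainOrdering n) (m : ℕ+) (k : ChainInstance n) :
    cost A (fun v => m * k v) = (m : ℕ) ^ 3 * cost A k := by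
  simp only [cost, Finset.mul_sum, PNat.mul_coe]
  exact Finset.sum_congr rfl fun t _ => by ring

theorem isUseful (A : ChainOrdering n) : IsUseful A := by
  obtain ⟨f, -, hf⟩ := A.exists_linear_optimal 1 one_pos
  set e : Fin (n + 1) → ℕ := fun v => if 0 < v ∧ v < Fin.last n then f v else 0
  have hopt := hf e (fun v h₁ h₂ => by simp [e, h₁, h₂]) (by simp [e]) (by simp [e])
  obtain ⟨Q, hQ⟩ : ∃ Q, Q = A.weight
    (fun t => e t.1 * e t.2.1 + e t.1 * e t.2.2 + e t.2.1 * e t.2.2) := ⟨_, rfl⟩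
  obtain ⟨C, hC⟩ : ∃ C, C = A.weight (fun t => e t.1 * e t.2.1 * e t.2.2) := ⟨_, rfl⟩
  -- With `N = Q + C + 1`, the lower-order part `N * Q + C` of the cost of `A` stays below `N ^ 2`,
  -- the least gap in the linear term.
  obtain ⟨k, hk⟩ : ∃ k : ChainInstance n, ∀ v, (k v : ℕ) = Q + C + 1 + e v :=
    ⟨fun v => (Q + C + e v).succPNat, fun v => by rw [Nat.succPNat_coe]; omega⟩
  refine ⟨k, fun B hB => ?_⟩
  rw [cost_add A (Q + C + 1) e k hk, cost_add B (Q + C + 1) e k hk, ← hQ, ← hC]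
  have hcard : A.weight (fun _ => 1) = B.weight (fun _ => 1) := by
    have h₁ := A.card_triplets
    have h₂ := B.card_triplets
    omega
  rw [hcard]
  have h := Nat.mul_le_mul_left ((Q + C + 1) ^ 2) (hopt B hB)
  have h' : (Q + C + 1) * Q + C < (Q + C + 1) ^ 2 := by nlinarith [Nat.zero_le (Q * C)]
  rw [Nat.succ_eq_add_one, Nat.mul_add, Nat.mul_one] at h
  have h'' := Nat.zero_le ((Q + C + 1) *
    B.weight (fun t => e t.1 * e t.2.1 + e t.1 * e t.2.2 + e t.2.1 * e t.2.2))
  omega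

end ChainOrdering

theorem mainTheorem3 (n : ℕ) (hn : 1 ≤ n) (A : ChainOrdering n) :
    {k : ChainInstance n | ChainOrdering.IsUniquelyOptimal A k}.Infinite ∧
      ChainOrdering.IsUseful A := by
  refine ⟨?_, A.isUseful⟩
  obtain ⟨k, hk⟩ := A.isUseful
  refine Set.infinite_of_injective_forall_mem (f := fun (m : ℕ+) v => m * k v)
    (fun m₁ m₂ h => mul_right_cancel (congrFun h 0)) fun m B hB => ?_
  rw [ChainOrdering.cost_mul, ChainOrdering.cost_mul]
  exact Nat.mul_lt_mul_of_pos_left (hk B hB) (pow_pos m.pos 3)
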